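/- A circular pizza is cut by radial cuts into $n\ge 1$ pieces $p_0,\dots,p_{n-1}$, listed in cyclic order, with real sizes $s(p_i)\ge 0$ (size $0$ is allowed). Alice and Bob eat the whole pizza by alternately picking one uneaten piece at a time. Alice picks first and may pick any piece; afterwards every picked piece must be adjacent (in the cyclic order) to some previously eaten piece. **Theorem.** For every such pizza Alice has a strategy that guarantees, whatever Bob does, that the total size of the pieces she eats is at least $\frac49\sum_{i=0}^{n-1}s(p_i)$. -/

import Mathlib

namespace Pizza

/-- The pieces of a circular pizza with `n` pieces are the elements of `ZMod n` in cyclic order.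
Two pieces are adjacent if they follow each other in this order. (For `n = 1` the only piece is
related to itself, which is harmless since a piece is never eaten twice.) -/
def Adjacent {n : ℕ} (p q : ZMod n) : Prop := p = q + 1 ∨ q = p + 1

/-- A history lists the pieces eaten so far, the most recently eaten one first. Eating `p` next is
legal if `p` is uneaten and, unless `p` is the very first piece, adjacent to an eaten piece. -/
def Legal {n : ℕ} (h : List (ZMod n)) (p : ZMod n) : Prop :=
  p ∉ h ∧ (h = [] ∨ ∃ q ∈ h, Adjacent p q)

/-- Alice picks the first piece and the players alternate, so that it is Alice's turn exactly when
an even number of pieces has been eaten. -/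
def AliceTurn {n : ℕ} (h : List (ZMod n)) : Prop := Even h.length

/-- `Reachable σ h`: the history `h` can arise when Alice plays according to the strategy `σ`
(a function of the whole history) and Bob makes arbitrary legal moves. -/
inductive Reachable {n : ℕ} (σ : List (ZMod n) → ZMod n) : List (ZMod n) → Prop
  | start : Reachable σ []
  | alice (h : List (ZMod n)) : Reachable σ h → AliceTurn h → Legal h (σ h) →
      Reachable σ (σ h :: h)
  | bob (h : List (ZMod n)) (p : ZMod n) : Reachable σ h → ¬ AliceTurn h → Legal h p →
      Reachable σ (p :: h)

/-- All pieces have been eaten. -/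
def Finished {n : ℕ} (h : List (ZMod n)) : Prop := ∀ p, p ∈ h

/-- `σ` is a strategy for Alice: it gives her a legal move whenever it is her turn in an unfinished
game that she has played according to `σ`. -/
def IsStrategy {n : ℕ} (σ : List (ZMod n) → ZMod n) : Prop :=
  ∀ h, Reachable σ h → AliceTurn h → ¬ Finished h → Legal h (σ h)

open Classical in
/-- The total size of the pieces eaten by Alice in the history `h`. -/
noncomputable def aliceOutcome {n : ℕ} (size : ZMod n → ℝ) : List (ZMod n) → ℝ
  | [] => 0
  | p :: h => (if AliceTurn h then size p else 0) + aliceOutcome size h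

/-- Alice has a strategy with which she eats pieces of total size at least `c`, however Bob
plays. -/
def AliceCanEat {n : ℕ} (size : ZMod n → ℝ) (c : ℝ) : Prop :=
  ∃ σ : List (ZMod n) → ZMod n, IsStrategy σ ∧
    ∀ h, Reachable σ h → Finished h → c ≤ aliceOutcome size h

end Pizza

/-!
If the number of pieces is even, Alice picks the better one of the two classes of an alternating
colouring: she starts in it and always eats the piece that Bob has just made accessible ("follows
Bob").

Let the number of pieces be `n = 2 * m + 1`. If Alice starts at `x` and follows Bob, she ends up with
`m + 1` pieces that alternate along the pizza except at one cut, where both neighbouring pieces are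
hers; Bob chooses the cut among those for which `x` is one of these pieces
(`Pizza.aliceCanEat_of_le_altSum`). Call the total size of these pieces the cut sum. If following Bob
never yields four ninths, then every piece belongs to a cut whose cut sum is less than that, and three
of these cuts divide the pizza into segments of odd length (`Pizza.exists_cutTriple`). Take such a
triple for which the sum of the three cut sums is minimal. Then moving one of the cuts by an even
distance inside an adjacent segment does not decrease its cut sum (`Pizza.MinCutTriple.le_add`,
`Pizza.MinCutTriple.le_sub`).

Let `oᵢ` and `eᵢ` be the total sizes of the pieces with an odd, respectively even, number within the
`i`-th segment, the first piece having number one. The three cut sums are `eᵢ + oⱼ + oₖ`. Alice can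
start in the `i`-th segment and play there in such a way that Bob has to leave the segment first.
From then on she follows Bob, and minimality shows that in the end she has at least
`eᵢ / 2 + oᵢ / 4 + min (eⱼ + oₖ) (oⱼ + eₖ)` (`Pizza.MinCutTriple.aliceCanEat`).
The play inside the segment is the content of `Pizza.exists_lineWin_segment`: she follows Bob, except
that she eats on the side opposite to him at most twice, each time switching between the two classes
of pieces of the segment.

Finally, if `eᵢ - oᵢ` is largest for `i = 1` and smallest for `i = 3`, then the cut sum
`e₁ + o₂ + o₃` with weight `3 / 4`, the strategy for the third segment with weight `1` and the one for
the first segment with weight `1 / 2` add up to at least the whole pizza, while the weights add up to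
`9 / 4`. So one of the three is at least four ninths.
-/

namespace Pizza

/-! ### From the circular pizza to a line -/

/-- The game after Alice's first move, unrolled to a line on which the piece at the integer `i` has
size `f i`: the pieces at the positions in `[l, r)` have been eaten, Bob is to move, and `t` rounds (a
move of Bob and an answer of Alice) are to be played. `LineWin f t l r c` says that Alice can gain at
least `c` in these rounds. Bob eats `l - 1` or `r`, and Alice answers on the same side (the first
alternative in each pair) or on the other one. -/
def LineWin (f : ℤ → ℝ) : ℕ → ℤ → ℤ → ℝ → Prop
  | 0, _, _, c => c ≤ 0
  | t + 1, l, r, c =>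
    (LineWin f t (l - 2) r (c - f (l - 2)) ∨ LineWin f t (l - 1) (r + 1) (c - f r)) ∧
    (LineWin f t l (r + 2) (c - f (r + 1)) ∨ LineWin f t (l - 1) (r + 1) (c - f (l - 1)))

/-- An invariant that Alice can restore after each move of Bob yields a strategy. -/
theorem aliceCanEat_of_invariant {n : ℕ} {size : ZMod n → ℝ} {c : ℝ} (I : List (ZMod n) → Prop)
    (h0 : I [])
    (hA : ∀ h, I h → AliceTurn h → ¬ Finished h → ∃ p, Legal h p ∧ I (p :: h))
    (hB : ∀ h p, I h → ¬ AliceTurn h → Legal h p → I (p :: h))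
    (hF : ∀ h, I h → Finished h → c ≤ aliceOutcome size h) : AliceCanEat size c := by
  classical
  let σ : List (ZMod n) → ZMod n := fun h =>
    if H : ∃ p, Legal h p ∧ I (p :: h) then H.choose else 0
  have hσ : ∀ h, (∃ p, Legal h p ∧ I (p :: h)) → Legal h (σ h) ∧ I (σ h :: h) := by
    intro h H
    simp only [σ, dif_pos H]
    exact H.choose_spec
  have hI : ∀ h, Reachable σ h → I h := by
    intro h hr
    induction hr with
    | start => exact h0
    | alice h _ ht hl ih => exact (hσ h (hA h ih ht fun hf => hl.1 (hf _))).2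
    | bob h p _ ht hl ih => exact hB h p ih ht hl
  exact ⟨σ, fun h hr ht hf => (hσ h (hA h (hI h hr) ht hf)).1, fun h hr hf => hF h (hI h hr) hf⟩

/-- The history `h` consists of the pieces at the positions in `[l, r)`, counted from `b`. -/
def Covers {n : ℕ} (b : ZMod n) (h : List (ZMod n)) (l r : ℤ) : Prop :=
  r - l = h.length ∧ ∀ p, p ∈ h ↔ ∃ i : ℤ, l ≤ i ∧ i < r ∧ b + (i : ZMod n) = p

section Unrolling

variable {n : ℕ} {b : ZMod n} {h : List (ZMod n)} {l r : ℤ}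

theorem Covers.cons_left (H : Covers b h l r) :
    Covers b ((b + ((l - 1 : ℤ) : ZMod n)) :: h) (l - 1) r := by
  refine ⟨by have := H.1; push_cast [List.length_cons]; linarith, fun p => ?_⟩
  rw [List.mem_cons, H.2]
  constructor
  · rintro (rfl | ⟨i, h1, h2, rfl⟩)
    · exact ⟨l - 1, le_rfl, by have := H.1; omega, rfl⟩
    · exact ⟨i, by omega, h2, rfl⟩
  · rintro ⟨i, h1, h2, rfl⟩
    rcases h1.eq_or_lt with rfl | h1
    · exact Or.inl rfl
    · exact Or.inr ⟨i, by omega, h2, rfl⟩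

theorem Covers.cons_right (H : Covers b h l r) : Covers b ((b + (r : ZMod n)) :: h) l (r + 1) := by
  refine ⟨by have := H.1; push_cast [List.length_cons]; linarith, fun p => ?_⟩
  rw [List.mem_cons, H.2]
  constructor
  · rintro (rfl | ⟨i, h1, h2, rfl⟩)
    · exact ⟨r, by have := H.1; omega, by omega, rfl⟩
    · exact ⟨i, h1, by omega, rfl⟩
  · rintro ⟨i, h1, h2, rfl⟩
    rcases (show i ≤ r by omega).eq_or_lt with rfl | h2
    · exact Or.inl rfl
    · exact Or.inr ⟨i, h1, h2, rfl⟩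

theorem Covers.finished_iff [NeZero n] (H : Covers b h l r) : Finished h ↔ n ≤ h.length := by
  have hn : (0 : ℤ) < n := by exact_mod_cast NeZero.pos n
  constructor
  · intro hf
    have hsub : (Finset.univ : Finset (ZMod n)) ⊆ h.toFinset := fun p _ => by simpa using hf p
    have := (Finset.card_le_card hsub).trans (List.toFinset_card_le h)
    rwa [Finset.card_univ, ZMod.card] at this
  · intro hl p
    rw [H.2]
    obtain ⟨z, hz⟩ := ZMod.intCast_surjective (p - b)
    refine ⟨l + (z - l) % n, by have := Int.emod_nonneg (z - l) hn.ne'; omega, ?_, ?_⟩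
    · have := Int.emod_lt_of_pos (z - l) hn
      have := H.1
      omega
    · have : ((l + (z - l) % n : ℤ) : ZMod n) = (z : ℤ) := by
        rw [ZMod.intCast_eq_intCast_iff]
        have := Int.mod_modEq (z - l) n
        simpa using this.add_left l
      rw [this, hz]; ring

theorem Covers.notMem [NeZero n] (H : Covers b h l r) {j : ℤ} (h1 : r - n ≤ j) (h2 : j < l) :
    b + (j : ZMod n) ∉ h := by
  rw [H.2]
  rintro ⟨i, hi1, hi2, hi⟩
  have := (ZMod.intCast_eq_intCast_iff_dvd_sub _ _ _).1 (add_left_cancel hi)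
  obtain ⟨q, hq⟩ := this
  have hq1 : (n : ℤ) * q < 0 := by omega
  have hq2 : -(n : ℤ) < n * q := by omega
  have hnp : (0 : ℤ) < n := by exact_mod_cast NeZero.pos n
  have : q < 0 := by nlinarith
  have : -1 < q := by nlinarith
  omega

theorem Covers.notMem_left [NeZero n] (H : Covers b h l r) (hn : h.length < n) :
    b + ((l - 1 : ℤ) : ZMod n) ∉ h :=
  H.notMem (by have := H.1; omega) (by omega)

theorem Covers.notMem_right [NeZero n] (H : Covers b h l r) (hn : h.length < n) :
    b + (r : ZMod n) ∉ h := by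
  have := H.notMem (j := r - n) le_rfl (by have := H.1; omega)
  simpa using this

theorem Covers.legal_left [NeZero n] (H : Covers b h l r) (hn : h.length < n) (hne : h ≠ []) :
    Legal h (b + ((l - 1 : ℤ) : ZMod n)) := by
  have := List.length_pos_iff.2 hne
  refine ⟨H.notMem_left hn, Or.inr ⟨b + (l : ZMod n), ?_, Or.inr ?_⟩⟩
  · exact (H.2 _).2 ⟨l, le_rfl, by have := H.1; omega, rfl⟩
  · push_cast; ring

theorem Covers.legal_right [NeZero n] (H : Covers b h l r) (hn : h.length < n) (hne : h ≠ []) :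
    Legal h (b + (r : ZMod n)) := by
  have := List.length_pos_iff.2 hne
  refine ⟨H.notMem_right hn, Or.inr ⟨b + ((r - 1 : ℤ) : ZMod n), ?_, Or.inl ?_⟩⟩
  · exact (H.2 _).2 ⟨r - 1, by have := H.1; omega, by omega, rfl⟩
  · push_cast; ring

theorem Covers.eq_of_legal (H : Covers b h l r) (hne : h ≠ []) {p : ZMod n} (hp : Legal h p) :
    p = b + ((l - 1 : ℤ) : ZMod n) ∨ p = b + (r : ZMod n) := by
  obtain ⟨hp, rfl | ⟨q, hq, ha⟩⟩ := hp
  · exact absurd rfl hne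
  obtain ⟨i, h1, h2, rfl⟩ := (H.2 q).1 hq
  rcases ha with rfl | ha
  · right
    by_contra hc
    refine hp ((H.2 _).2 ⟨i + 1, by omega, ?_, by push_cast; ring⟩)
    rcases (show i + 1 ≤ r by omega).eq_or_lt with e | e
    · exact absurd (by rw [← e]; push_cast; ring) hc
    · exact e
  · left
    have hpe : p = b + ((i - 1 : ℤ) : ZMod n) := by
      rw [eq_sub_of_add_eq ha.symm]; push_cast; ring
    subst hpe
    by_contra hc
    refine hp ((H.2 _).2 ⟨i - 1, ?_, by omega, rfl⟩)
    rcases h1.eq_or_lt with e | e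
    · exact absurd (by rw [e]) hc
    · omega

/-- Alice starts with the piece at position `x` and then plays the game on the line. If `n` is even,
Bob makes the last move, for which no round is counted. -/
theorem aliceCanEat_of_lineWin [NeZero n] {size : ZMod n → ℝ} {c : ℝ} (b : ZMod n) (x : ℤ)
    (hx : LineWin (fun i => size (b + (i : ZMod n))) ((n - 1) / 2) x (x + 1)
      (c - size (b + (x : ZMod n)))) :
    AliceCanEat size c := by
  set f : ℤ → ℝ := fun i => size (b + (i : ZMod n)) with hf
  have hn := NeZero.pos n
  -- In every position, what Alice has eaten and what she can still gain add up to `c`; the two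
  -- disjuncts for an even length are the finished game and Alice's choice between two moves.
  let I : List (ZMod n) → Prop := fun h => h = [] ∨ ∃ l r : ℤ, Covers b h l r ∧ h.length ≤ n ∧
    ((Odd h.length ∧ LineWin f ((n - h.length) / 2) l r (c - aliceOutcome size h)) ∨
     (Even h.length ∧ h ≠ [] ∧ ((n = h.length ∧ c ≤ aliceOutcome size h) ∨ (h.length < n ∧
      (LineWin f ((n - h.length - 1) / 2) (l - 1) r (c - aliceOutcome size h - f (l - 1)) ∨
       LineWin f ((n - h.length - 1) / 2) l (r + 1) (c - aliceOutcome size h - f r))))))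
  have hout : ∀ (h : List (ZMod n)) p, Even h.length →
      aliceOutcome size (p :: h) = size p + aliceOutcome size h := fun h p he => by
    rw [aliceOutcome, if_pos (show AliceTurn h from he)]
  have hout' : ∀ (h : List (ZMod n)) p, Odd h.length →
      aliceOutcome size (p :: h) = aliceOutcome size h := fun h p he => by
    rw [aliceOutcome, if_neg (by rwa [AliceTurn, Nat.not_even_iff_odd]), zero_add]
  refine aliceCanEat_of_invariant I (Or.inl rfl) ?_ ?_ ?_
  · rintro h (rfl | ⟨l, r, hc, hln, ⟨ho, _⟩ | ⟨he, hne, ⟨hl, _⟩ | ⟨hl, hw⟩⟩⟩) ht hnf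
    · refine ⟨b + (x : ZMod n), ⟨by simp, Or.inl rfl⟩, Or.inr ⟨x, x + 1, ?_, ?_, Or.inl ⟨?_, ?_⟩⟩⟩
      · refine ⟨by simp, fun p => ?_⟩
        rw [List.mem_singleton]
        constructor
        · rintro rfl
          exact ⟨x, le_rfl, by omega, rfl⟩
        · rintro ⟨i, h1, h2, rfl⟩
          rw [show i = x by omega]
      · simpa using Nat.succ_le_of_lt hn
      · simp
      · rw [hout _ _ (by simp)]
        simpa [aliceOutcome] using hx
    · exact absurd ht (by rwa [AliceTurn, Nat.not_even_iff_odd])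
    · exact absurd (hc.finished_iff.2 hl.le) hnf
    · have hlen : ∀ p, (p :: h).length = h.length + 1 := fun p => rfl
      rcases hw with hw | hw
      · refine ⟨_, hc.legal_left hl hne, Or.inr ⟨_, _, hc.cons_left, hl, Or.inl ⟨?_, ?_⟩⟩⟩
        · exact he.add_one
        · rw [hout _ _ he, hlen, ← Nat.sub_sub]
          convert hw using 1
          ring
      · refine ⟨_, hc.legal_right hl hne, Or.inr ⟨_, _, hc.cons_right, hl, Or.inl ⟨?_, ?_⟩⟩⟩
        · exact he.add_one
        · rw [hout _ _ he, hlen, ← Nat.sub_sub]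
          convert hw using 1
          ring
  · rintro h p (rfl | ⟨l, r, hc, hln, ⟨ho, hw⟩ | ⟨he, _⟩⟩) ht hp
    · exact absurd (by simp [AliceTurn]) ht
    · have hne : h ≠ [] := by rintro rfl; simp at ho
      have hl : h.length < n := by
        by_contra hcon
        exact hp.1 (hc.finished_iff.2 (not_lt.1 hcon) p)
      have hlen : (p :: h).length = h.length + 1 := rfl
      have key : (n = h.length + 1 ∧ c ≤ aliceOutcome size h) ∨ (h.length + 1 < n ∧
          ∃ t, (n - h.length) / 2 = t + 1 ∧ (n - (h.length + 1) - 1) / 2 = t) := by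
        rcases (Nat.succ_le_of_lt hl).eq_or_lt with e | e
        · left
          refine ⟨e.symm, ?_⟩
          rw [show (n - h.length) / 2 = 0 by omega, LineWin] at hw
          linarith
        · exact Or.inr ⟨e, (n - (h.length + 1) - 1) / 2, by omega, rfl⟩
      rcases hc.eq_of_legal hne hp with rfl | rfl
      · refine Or.inr ⟨_, _, hc.cons_left, hl, Or.inr ⟨ho.add_one, by simp, ?_⟩⟩
        rw [hout' _ _ ho, hlen]
        refine key.imp id fun ⟨h1, t, h2, h3⟩ => ⟨h1, ?_⟩
        rw [h2, LineWin] at hw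
        rw [h3, show l - 1 - 1 = l - 2 by ring]
        exact hw.1
      · refine Or.inr ⟨_, _, hc.cons_right, hl, Or.inr ⟨ho.add_one, by simp, ?_⟩⟩
        rw [hout' _ _ ho, hlen]
        refine key.imp id fun ⟨h1, t, h2, h3⟩ => ⟨h1, ?_⟩
        rw [h2, LineWin] at hw
        rw [h3, show r + 1 + 1 = r + 2 by ring]
        exact hw.2.symm
    · exact absurd he ht
  · rintro h (rfl | ⟨l, r, hc, hln, ⟨ho, hw⟩ | ⟨he, _, ⟨_, hw⟩ | ⟨hl, _⟩⟩⟩) hfin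
    · exact absurd (hfin 0) (by simp)
    · have := hc.finished_iff.1 hfin
      rw [show (n - h.length) / 2 = 0 by omega, LineWin] at hw
      linarith
    · exact hw
    · exact absurd (hc.finished_iff.1 hfin) (not_le.2 hl)

end Unrolling

/-! ### Playing inside a segment -/

/-- Total size of the first `i` pieces at even positions. -/
noncomputable def evenSum (f : ℤ → ℝ) (i : ℕ) : ℝ := ∑ j ∈ Finset.range i, f (2 * j)

/-- Total size of the first `i` pieces at odd positions. -/
noncomputable def oddSum (f : ℤ → ℝ) (i : ℕ) : ℝ := ∑ j ∈ Finset.range i, f (2 * j + 1)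

theorem evenSum_zero (f : ℤ → ℝ) : evenSum f 0 = 0 := rfl

theorem oddSum_zero (f : ℤ → ℝ) : oddSum f 0 = 0 := rfl

theorem evenSum_succ (f : ℤ → ℝ) (i : ℕ) : evenSum f (i + 1) = evenSum f i + f (2 * i) :=
  Finset.sum_range_succ _ _

theorem oddSum_succ (f : ℤ → ℝ) (i : ℕ) : oddSum f (i + 1) = oddSum f i + f (2 * i + 1) :=
  Finset.sum_range_succ _ _

theorem evenSum_mono {f : ℤ → ℝ} (hf : ∀ i, 0 ≤ f i) : Monotone (evenSum f) :=
  monotone_nat_of_le_succ fun i => by rw [evenSum_succ]; linarith [hf (2 * i)]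

theorem oddSum_mono {f : ℤ → ℝ} (hf : ∀ i, 0 ≤ f i) : Monotone (oddSum f) :=
  monotone_nat_of_le_succ fun i => by rw [oddSum_succ]; linarith [hf (2 * i + 1)]

/-- Alice always answers on the side where Bob has just eaten. If Bob plays `s` of the rounds on the
left, she gains every second piece of the `2 * s` pieces on the left and of the remaining pieces on
the right. -/
theorem lineWin_follow (f : ℤ → ℝ) (t : ℕ) (l r : ℤ) (c : ℝ)
    (H : ∀ s ≤ t, c ≤ ∑ i ∈ Finset.range s, f (l - 2 - 2 * i) +
      ∑ i ∈ Finset.range (t - s), f (r + 1 + 2 * i)) : LineWin f t l r c := by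
  induction t generalizing l r c with
  | zero => simpa [LineWin] using H 0 le_rfl
  | succ t ih =>
    refine ⟨Or.inl (ih _ _ _ fun s hs => ?_), Or.inl (ih _ _ _ fun s hs => ?_)⟩
    · have := H (s + 1) (by omega)
      rw [Finset.sum_range_succ', Nat.add_sub_add_right] at this
      have e : ∀ i : ℕ, l - 2 - 2 * ((i + 1 : ℕ) : ℤ) = l - 2 - 2 - 2 * i := fun i => by
        push_cast; ring
      simp only [e] at this
      simp only [Nat.cast_zero, mul_zero, sub_zero] at this
      linarith
    · have := H s (by omega)
      rw [Nat.sub_add_comm hs, Finset.sum_range_succ'] at this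
      have e : ∀ i : ℕ, r + 1 + 2 * ((i + 1 : ℕ) : ℤ) = r + 2 + 1 + 2 * i := fun i => by
        push_cast; ring
      simp only [e] at this
      simp only [Nat.cast_zero, mul_zero, add_zero] at this
      linarith

theorem LineWin.of_eq {f : ℤ → ℝ} {t t' : ℕ} {l l' r r' x x' : ℤ} {c : ℝ}
    (H : LineWin f t l r (c - f x)) (ht : t = t' := by omega) (hl : l = l' := by omega)
    (hr : r = r' := by omega) (hx : x = x' := by omega) : LineWin f t' l' r' (c - f x') := by
  subst ht hl hr hx
  exact H

section Segment

variable {f : ℤ → ℝ} {m k : ℕ} {M : ℝ}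

/-- The outermost pieces eaten so far are at the odd positions `2 * p + 1` and `2 * q + 1` of the
segment `[0, 2 * k]`. Alice follows Bob and thus collects odd positions until Bob eats an end of the
segment; she then eats at the other side, and the eaten interval is `[0, 2 * s]` or `[2 * s, 2 * k]`.
By `hR` and `hL`, from there on the even positions of that interval together with her further gain
can be brought to `M`. The amount `C` is what she needs in total if the pieces at the odd positions
from `2 * p + 1` to `2 * q + 1` are counted as hers; it does not change while she follows Bob. -/
theorem lineWin_odd_phase (hk : k ≤ m)
    (hR : ∀ s ≤ k, ∀ c, c + evenSum f (s + 1) ≤ M → LineWin f (m - s) 0 (2 * s + 1) c)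
    (hL : ∀ s ≤ k, ∀ c, c + (evenSum f (k + 1) - evenSum f s) ≤ M →
      LineWin f (m - (k - s)) (2 * s) (2 * k + 1) c)
    {C : ℝ} (p q : ℕ) (c : ℝ) (hpq : p ≤ q) (hq : q < k)
    (hC : C = c + oddSum f (q + 1) - oddSum f p)
    (h1 : ∀ s, q < s → s ≤ k → C ≤ M - (evenSum f s - oddSum f s))
    (h2 : ∀ s ≤ p, C ≤ M + (evenSum f (s + 1) - oddSum f s) - (evenSum f (k + 1) - oddSum f k)) :
    LineWin f (m - (q - p)) (2 * p + 1) (2 * q + 2) c := by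
  obtain ⟨j, hj⟩ : ∃ j, p + k = j + (q + 1) := ⟨p + k - (q + 1), by omega⟩
  induction j generalizing p q c with
  | zero =>
    obtain rfl : p = 0 := by omega
    obtain rfl : k = q + 1 := by omega
    rw [show m - (q - 0) = (m - (q + 1)) + 1 by omega]
    rw [oddSum_zero] at hC
    refine ⟨Or.inr ?_, Or.inr ?_⟩
    · have := h1 (q + 1) (by omega) le_rfl
      refine (hR (q + 1) le_rfl (c - f (2 * (q + 1 : ℕ))) ?_).of_eq
      rw [evenSum_succ]
      linarith
    · have := h2 0 le_rfl
      refine (hL 0 (by omega) (c - f (2 * (0 : ℕ))) ?_).of_eq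
      rw [evenSum_succ f 0, oddSum_zero] at this
      linarith
  | succ j ih =>
    rw [show m - (q - p) = (m - (q - p) - 1) + 1 by omega]
    constructor
    · rcases p with _ | p
      · right
        have := h1 (q + 1) (by omega) (by omega)
        rw [oddSum_zero] at hC
        refine (hR (q + 1) (by omega) (c - f (2 * (q + 1 : ℕ))) ?_).of_eq
        rw [evenSum_succ]
        linarith
      · left
        refine (ih p q (c - f (2 * p + 1)) (by omega) hq ?_ h1
          (fun s hs => h2 s (by omega)) (by omega)).of_eq
        rw [hC, oddSum_succ f p]; ring
    · rcases (Nat.succ_le_of_lt hq).eq_or_lt with rfl | hq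
      · right
        have := h2 p le_rfl
        refine (hL p (by omega) (c - f (2 * p)) ?_).of_eq
        rw [evenSum_succ f p] at this
        rw [Nat.succ_eq_add_one] at *
        linarith
      · left
        refine (ih p (q + 1) (c - f (2 * (q + 1 : ℕ) + 1)) (by omega) hq ?_
          (fun s hs => h1 s (by omega)) h2 (by omega)).of_eq
        rw [hC, oddSum_succ f (q + 1)]; ring

/-- The outermost pieces eaten so far are at the even positions `2 * (p + 1)` and `2 * q`. Alice
follows Bob and thus collects even positions until Bob eats `2 * P + 1` or `2 * Q + 1`; she then eats
on the other side and turns to the odd positions, where `hodd` describes the rest of the game. -/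
theorem lineWin_even_phase (hk : k ≤ m)
    (hodd : ∀ (p q : ℕ) (c C : ℝ), p ≤ q → q < k → C = c + oddSum f (q + 1) - oddSum f p →
      (∀ s, q < s → s ≤ k → C ≤ M - (evenSum f s - oddSum f s)) →
      (∀ s ≤ p, C ≤ M + (evenSum f (s + 1) - oddSum f s) - (evenSum f (k + 1) - oddSum f k)) →
      LineWin f (m - (q - p)) (2 * p + 1) (2 * q + 2) c)
    {P Q z : ℕ} {C : ℝ} (hQ : Q < k)
    (hleft : ∀ q, z ≤ q → q ≤ Q →
      (∀ s, q < s → s ≤ k → C - (evenSum f (q + 1) - oddSum f q) + (evenSum f (P + 1) - oddSum f P)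
        ≤ M - (evenSum f s - oddSum f s)) ∧
      (∀ s ≤ P, C - (evenSum f (q + 1) - oddSum f q) + (evenSum f (P + 1) - oddSum f P)
        ≤ M + (evenSum f (s + 1) - oddSum f s) - (evenSum f (k + 1) - oddSum f k)))
    (hright : ∀ p, P ≤ p → p < z →
      (∀ s, Q < s → s ≤ k → C - (evenSum f (Q + 1) - oddSum f (Q + 1)) +
        (evenSum f (p + 1) - oddSum f (p + 1)) ≤ M - (evenSum f s - oddSum f s)) ∧
      (∀ s ≤ p, C - (evenSum f (Q + 1) - oddSum f (Q + 1)) +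
        (evenSum f (p + 1) - oddSum f (p + 1))
        ≤ M + (evenSum f (s + 1) - oddSum f s) - (evenSum f (k + 1) - oddSum f k)))
    (p q : ℕ) (c : ℝ) (hp : P ≤ p) (hpz : p < z) (hzq : z ≤ q)
    (hq : q ≤ Q) (hC : C = c + evenSum f (q + 1) - evenSum f (p + 1)) :
    LineWin f (m - (q - (p + 1))) (2 * (p + 1 : ℕ)) (2 * q + 1) c := by
  obtain ⟨j, hj⟩ : ∃ j, p + Q = j + (P + q) := ⟨p + Q - (P + q), by omega⟩
  -- answers to a step of Bob across the left, respectively right, end of the inner region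
  have jumpR : ∀ q, z ≤ q → q ≤ Q → ∀ c, C = c + evenSum f (q + 1) - evenSum f (P + 1) →
      LineWin f (m - (q - P)) (2 * P + 1) (2 * q + 2) (c - f (2 * q + 1)) := fun q hzq hq c hC => by
    obtain ⟨h1, h2⟩ := hleft q hzq hq
    refine hodd P q _ _ (by omega) (by omega) ?_ h1 h2
    rw [hC, oddSum_succ f q]; ring
  have jumpL : ∀ p, P ≤ p → p < z → z ≤ Q → ∀ c,
      C = c + evenSum f (Q + 1) - evenSum f (p + 1) →
      LineWin f (m - (Q - p)) (2 * p + 1) (2 * Q + 2) (c - f (2 * p + 1)) :=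
    fun p hp hpz hz c hC => by
    obtain ⟨h1, h2⟩ := hright p hp hpz
    refine hodd p Q _ _ (by omega) hQ ?_ h1 h2
    rw [hC, oddSum_succ f p]; ring
  induction j generalizing p q c with
  | zero =>
    obtain rfl : p = P := by omega
    obtain rfl : q = Q := by omega
    rw [show m - (q - (p + 1)) = (m - (q - p)) + 1 by omega]
    exact ⟨Or.inr (jumpR q hzq hq c hC).of_eq, Or.inr (jumpL p hp hpz hzq c hC).of_eq⟩
  | succ j ih =>
    rw [show m - (q - (p + 1)) = (m - (q - p)) + 1 by omega]
    constructor
    · rcases hp.eq_or_lt with rfl | hp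
      · exact Or.inr (jumpR q hzq hq c hC).of_eq
      · left
        obtain ⟨p, rfl⟩ : ∃ p', p = p' + 1 := ⟨p - 1, by omega⟩
        refine (ih p q (c - f (2 * (p + 1 : ℕ))) (by omega) (by omega) hzq hq ?_
          (by omega)).of_eq
        rw [hC, evenSum_succ f (p + 1)]; ring
    · rcases hq.eq_or_lt with rfl | hq
      · exact Or.inr (jumpL p hp hpz hzq c hC).of_eq
      · left
        refine (ih p (q + 1) (c - f (2 * (q + 1 : ℕ))) hp hpz (by omega) hq ?_
          (by omega)).of_eq
        rw [hC, evenSum_succ f (q + 1)]; ring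

/-- Alice starts inside the segment `[0, 2 * k]`, whose even positions have total size
`evenSum f (k + 1)` and whose odd positions have total size `oddSum f k`. If the former is at least
the latter, she starts at an end and follows Bob. Otherwise consider the walk which, as
one passes along the segment, goes up by the size of each piece at an even position and down by that
of each piece at an odd position. If the walk is above a lower threshold up to some odd position and
below an upper threshold from then on, Alice starts there and collects odd positions. Otherwise the
walk rises by more than half the size of the even positions, from below the lower threshold to above
the upper one. Alice then starts at the median of the even positions, collects even positions in the
region of that rise, and odd positions outside of it. -/
theorem exists_lineWin_segment (hf : ∀ i, 0 ≤ f i) (hk : k ≤ m)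
    (hR : ∀ s ≤ k, ∀ c, c + evenSum f (s + 1) ≤ M → LineWin f (m - s) 0 (2 * s + 1) c)
    (hL : ∀ s ≤ k, ∀ c, c + (evenSum f (k + 1) - evenSum f s) ≤ M →
      LineWin f (m - (k - s)) (2 * s) (2 * k + 1) c)
    {c : ℝ} (hc : c ≤ M - 3 / 4 * evenSum f (k + 1) + oddSum f k / 2) :
    ∃ x, LineWin f m x (x + 1) (c - f x) := by
  have hodd := fun (p q : ℕ) (c C : ℝ) => lineWin_odd_phase (C := C) hk hR hL p q c
  have hE := evenSum_mono hf
  have hO := oddSum_mono hf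
  have hE0 : ∀ i, 0 ≤ evenSum f i := fun i => hE (Nat.zero_le i)
  set A := evenSum f with hA
  set D := oddSum f with hD
  set W := A (k + 1) - D k with hW
  rcases le_or_gt 0 W with hW0 | hW0
  · refine ⟨0, (hR 0 (Nat.zero_le _) (c - f (2 * (0 : ℕ))) ?_).of_eq⟩
    have := hE0 (k + 1)
    rw [hA, evenSum_succ, evenSum_zero]
    linarith
  have hkpos : 0 < k := by
    rcases Nat.eq_zero_or_pos k with rfl | h
    · have := hE0 1
      simp only [hW, hD, oddSum_zero] at hW0
      simp only [zero_add] at hW0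
      linarith
    · exact h
  set hi := W / 2 + A (k + 1) / 4 with hhi
  set lo := W / 2 - A (k + 1) / 4 with hlo
  have hcW : c ≤ M - W / 2 - A (k + 1) / 4 := by linarith
  by_cases hgood : ∃ j < k, (∀ s, j < s → s ≤ k → A s - D s ≤ hi) ∧
      ∀ s ≤ j, lo ≤ A (s + 1) - D s
  · obtain ⟨j, hjk, h1, h2⟩ := hgood
    refine ⟨2 * j + 1, ?_⟩
    have := hodd j j (c - f (2 * j + 1)) c le_rfl hjk (by rw [hD, oddSum_succ]; ring)
      (fun s h h' => by linarith [h1 s h h']) (fun s h => by linarith [h2 s h])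
    exact this.of_eq
  -- The walk has its valleys `A s - D s` before, and its peaks `A (s + 1) - D s` after, the even
  -- positions. Below, `j = Q + 1` is the last valley above `hi`, and `P` the first peak below `lo`.
  have hex : ∃ j, ∀ s, j < s → s ≤ k → A s - D s ≤ hi := ⟨k, fun s h h' => by omega⟩
  classical
  obtain ⟨j, hj, hjmin⟩ : ∃ j, (∀ s, j < s → s ≤ k → A s - D s ≤ hi) ∧
      ∀ i < j, ¬ ∀ s, i < s → s ≤ k → A s - D s ≤ hi :=
    ⟨Nat.find hex, Nat.find_spec hex, fun i hi => Nat.find_min hex hi⟩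
  have hjk : j < k := by
    have : j ≤ k - 1 := by
      by_contra hcon
      refine hjmin (k - 1) (by omega) fun s h h' => ?_
      obtain rfl : s = k := by omega
      have := hE (Nat.le_succ s)
      have := hE0 (s + 1)
      rw [Nat.succ_eq_add_one] at *
      linarith
    omega
  have hex2 : ∃ P, P ≤ j ∧ A (P + 1) - D P < lo := by
    by_contra hcon
    push Not at hcon
    exact hgood ⟨j, hjk, hj, hcon⟩
  obtain ⟨P, ⟨hPj, hP⟩, hPmin⟩ : ∃ P, (P ≤ j ∧ A (P + 1) - D P < lo) ∧
      ∀ i < P, ¬ (i ≤ j ∧ A (i + 1) - D i < lo) :=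
    ⟨Nat.find hex2, Nat.find_spec hex2, fun i hi => Nat.find_min hex2 hi⟩
  have hPmin' : ∀ i < P, lo ≤ A (i + 1) - D i := fun i hi => by
    by_contra hcon
    exact hPmin i hi ⟨by omega, not_le.1 hcon⟩
  have hk1 := hE0 (k + 1)
  have hj0 : j ≠ 0 := by
    rintro rfl
    obtain rfl : P = 0 := by omega
    have := hE0 (0 + 1)
    rw [hD, oddSum_zero] at hP
    linarith
  obtain ⟨Q, rfl⟩ : ∃ Q, j = Q + 1 := ⟨j - 1, by omega⟩
  have hQ : hi < A (Q + 1) - D (Q + 1) := by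
    have := hjmin Q (Nat.lt_succ_self Q)
    push Not at this
    obtain ⟨s, h1, h2, h3⟩ := this
    rcases (Nat.succ_le_of_lt h1).eq_or_lt with rfl | h1
    · exact h3
    · exact absurd (hj s h1 h2) (not_le.2 h3)
  have hPQ : P < Q + 1 := by
    refine lt_of_le_of_ne hPj ?_
    rintro rfl
    have := hE (Nat.le_succ (Q + 1))
    rw [Nat.succ_eq_add_one] at this
    linarith
  -- `z` is the median of the even positions
  have hex3 : ∃ z, A (k + 1) / 2 ≤ A (z + 1) := ⟨k, by linarith⟩
  obtain ⟨z, hz, hzmin⟩ : ∃ z, A (k + 1) / 2 ≤ A (z + 1) ∧ ∀ i < z, ¬ A (k + 1) / 2 ≤ A (i + 1) :=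
    ⟨Nat.find hex3, Nat.find_spec hex3, fun i hi => Nat.find_min hex3 hi⟩
  have hz' : A z ≤ A (k + 1) / 2 := by
    rcases z with _ | z
    · rw [show A 0 = 0 from evenSum_zero f]; linarith
    · exact (not_le.1 (hzmin z (Nat.lt_succ_self z))).le
  have hDPQ := hO (show P ≤ Q + 1 by omega)
  have hAQ := hE (show Q + 1 ≤ k + 1 by omega)
  have hPz : P < z := by
    by_contra hcon
    have := hE (show z + 1 ≤ P + 1 by omega)
    linarith
  have hzQ : z ≤ Q := by
    by_contra hcon
    have := hE (show Q + 1 ≤ z by omega)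
    linarith [hE0 (P + 1)]
  refine ⟨2 * z, ?_⟩
  obtain ⟨y, rfl⟩ : ∃ y, z = y + 1 := ⟨z - 1, by omega⟩
  have key := lineWin_even_phase (P := P) (Q := Q) (z := y + 1) (C := c) hk hodd (by omega) ?_ ?_
    y (y + 1) (c - f (2 * (y + 1 : ℕ))) (by omega) (by omega) le_rfl hzQ
    (by rw [evenSum_succ f (y + 1)]; ring)
  · exact key.of_eq
  · intro q hzq hqQ
    have e1 := hE (show y + 1 + 1 ≤ q + 1 by omega)
    have e2 := hO (show q ≤ Q + 1 by omega)
    refine ⟨fun s h h' => ?_, fun s h => ?_⟩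
    · have := hO h.le
      have := hE (show s ≤ k + 1 by omega)
      linarith
    · rcases h.eq_or_lt with rfl | h
      · linarith
      · have := hPmin' s h
        linarith
  · intro p hPp hpz
    have e1 := hE (show p + 1 ≤ y + 1 by omega)
    have e2 := hO (show P ≤ p + 1 by omega)
    have e3 := hE0 (P + 1)
    refine ⟨fun s h h' => ?_, fun s h => ?_⟩
    · rcases (Nat.succ_le_of_lt h).eq_or_lt with rfl | h
      · rw [Nat.succ_eq_add_one]
        linarith
      · have := hj s h h'
        linarith
    · have := hO (show s ≤ p + 1 by omega)
      have := hE0 (s + 1)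
      linarith

end Segment
/-! ### Alternating sums and following Bob -/

section AltSum

variable {n : ℕ}

/-- Total size of `k` pieces, every second one, starting with `b`. For `n = 2 * m + 1` and
`k = m + 1` these pieces alternate along the whole pizza, except that the two pieces `b - 1` and `b`
next to a certain cut are both among them; this is the *cut sum* at `b`. -/
noncomputable def altSum (size : ZMod n → ℝ) (b : ZMod n) (k : ℕ) : ℝ :=
  ∑ i ∈ Finset.range k, size (b + 2 * i)

theorem altSum_add (size : ZMod n → ℝ) (b : ZMod n) (i j : ℕ) :
    altSum size b (i + j) = altSum size b i + altSum size (b + 2 * i) j := by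
  simp only [altSum, Finset.sum_range_add]
  congr 1
  refine Finset.sum_congr rfl fun x _ => ?_
  push_cast
  congr 1
  ring

theorem altSum_nonneg {size : ZMod n → ℝ} (hsize : ∀ p, 0 ≤ size p) (b : ZMod n) (k : ℕ) :
    0 ≤ altSum size b k :=
  Finset.sum_nonneg fun _ _ => hsize _

theorem evenSum_size (size : ZMod n → ℝ) (b : ZMod n) (k : ℕ) :
    evenSum (fun i => size (b + (i : ZMod n))) k = altSum size b k := by
  simp [evenSum, altSum]

theorem oddSum_size (size : ZMod n → ℝ) (b : ZMod n) (k : ℕ) :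
    oddSum (fun i => size (b + (i : ZMod n))) k = altSum size (b + 1) k := by
  simp only [oddSum, altSum]
  refine Finset.sum_congr rfl fun x _ => ?_
  push_cast
  congr 1
  ring

theorem sum_range_size [NeZero n] (size : ZMod n → ℝ) (b : ZMod n) :
    ∑ i ∈ Finset.range n, size (b + i) = ∑ p, size p := by
  refine Finset.sum_nbij' (fun i : ℕ => b + (i : ZMod n)) (fun p => (p - b).val) ?_ ?_ ?_ ?_ ?_
  · simp
  · intro p _
    exact Finset.mem_range.2 (ZMod.val_lt _)
  · intro i hi
    simp only [add_sub_cancel_left]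
    exact ZMod.val_cast_of_lt (Finset.mem_range.1 hi)
  · intro p _
    simp
  · simp

theorem sum_range_parity (g : ℕ → ℝ) (m : ℕ) :
    ∑ i ∈ Finset.range (2 * m), g i =
      ∑ i ∈ Finset.range m, g (2 * i) + ∑ i ∈ Finset.range m, g (2 * i + 1) := by
  induction m with
  | zero => simp
  | succ m ih =>
    rw [show 2 * (m + 1) = 2 * m + 1 + 1 by ring]
    simp only [Finset.sum_range_succ, ih]
    ring

theorem sum_size_of_even [NeZero n] (size : ZMod n → ℝ) (b : ZMod n) {m : ℕ} (hn : n = 2 * m) :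
    ∑ p, size p = altSum size b m + altSum size (b + 1) m := by
  rw [← sum_range_size size b]
  rw [show Finset.range n = Finset.range (2 * m) by rw [hn],
    sum_range_parity (fun i => size (b + (i : ZMod n)))]
  simp only [altSum]
  push_cast
  congr 1
  refine Finset.sum_congr rfl fun x _ => ?_
  congr 1
  ring

theorem sum_size_of_odd [NeZero n] (size : ZMod n → ℝ) (b : ZMod n) {m : ℕ} (hn : n = 2 * m + 1) :
    ∑ p, size p = altSum size b (m + 1) + altSum size (b + 1) m := by
  rw [← sum_range_size size b]
  rw [show Finset.range n = Finset.range (2 * m + 1) by rw [hn], Finset.sum_range_succ,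
    sum_range_parity (fun i => size (b + (i : ZMod n)))]
  simp only [altSum, Finset.sum_range_succ]
  push_cast
  rw [add_right_comm]
  congr 1
  refine Finset.sum_congr rfl fun x _ => ?_
  congr 1
  ring

/-- If Alice follows Bob, she ends up with an alternating sequence of pieces that contains
everything she had before, continued to both sides as far as Bob chooses. -/
theorem lineWin_of_le_altSum {size : ZMod n → ℝ} {b : ZMod n} {m j : ℕ} (hj : j ≤ m) (l : ℤ) (c : ℝ)
    (H : ∀ u ≤ m - j, c + altSum size (b + (l : ZMod n)) (j + 1) ≤
      altSum size (b + (l : ZMod n) - 2 * u) (m + 1)) :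
    LineWin (fun i => size (b + (i : ZMod n))) (m - j) l (l + 2 * j + 1) c := by
  refine lineWin_follow _ _ _ _ _ fun s hs => ?_
  have := H s hs
  rw [show m + 1 = s + ((j + 1) + (m - j - s)) by omega, altSum_add _ _ s, altSum_add _ _ (j + 1),
    sub_add_cancel] at this
  have e1 : altSum size (b + (l : ZMod n) - 2 * s) s =
      ∑ i ∈ Finset.range s, size (b + ((l - 2 - 2 * i : ℤ) : ZMod n)) := by
    rw [altSum, ← Finset.sum_range_reflect]
    refine Finset.sum_congr rfl fun i hi => ?_
    obtain ⟨d, rfl⟩ : ∃ d, s = i + 1 + d := ⟨s - (i + 1), by have := Finset.mem_range.1 hi; omega⟩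
    rw [show i + 1 + d - 1 - i = d by omega]
    push_cast
    congr 1
    ring
  have e2 : altSum size (b + (l : ZMod n) + 2 * (j + 1 : ℕ)) (m - j - s) =
      ∑ i ∈ Finset.range (m - j - s), size (b + ((l + 2 * j + 1 + 1 + 2 * i : ℤ) : ZMod n)) := by
    refine Finset.sum_congr rfl fun i hi => ?_
    push_cast
    congr 1
    ring
  linarith

theorem aliceCanEat_of_le_altSum [NeZero n] {size : ZMod n → ℝ} {c : ℝ} {m : ℕ}
    (hm : (n - 1) / 2 = m) (x : ZMod n) (H : ∀ s ≤ m, c ≤ altSum size (x - 2 * s) (m + 1)) :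
    AliceCanEat size c := by
  refine aliceCanEat_of_lineWin x 0 ?_
  rw [hm]
  refine (lineWin_of_le_altSum (b := x) (j := 0) (Nat.zero_le m) 0
    (c - size (x + ((0 : ℤ) : ZMod n))) fun u hu => ?_)
  simpa [altSum] using H u hu

/-- If the number of pieces is even, Alice can eat every second piece. -/
theorem aliceCanEat_of_even [NeZero n] {size : ZMod n → ℝ} {c : ℝ} {m : ℕ} (hn : n = 2 * (m + 1))
    (hc : c ≤ (∑ p, size p) / 2) : AliceCanEat size c := by
  have h0 : (2 : ZMod n) * (m + 1 : ℕ) = 0 := by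
    have : ((2 * (m + 1) : ℕ) : ZMod n) = 0 := by rw [← hn, ZMod.natCast_self]
    exact_mod_cast this
  have hper : ∀ (x : ZMod n) (s : ℕ), altSum size (x - 2 * s) (m + 1) = altSum size x (m + 1) := by
    intro x s
    induction s with
    | zero => simp
    | succ s ih =>
      rw [← ih]
      have h1 := altSum_add size (x - 2 * (s + 1 : ℕ)) (m + 1) 1
      have h2 := altSum_add size (x - 2 * (s + 1 : ℕ)) 1 (m + 1)
      rw [h0] at h1
      rw [add_comm 1 (m + 1), h1] at h2
      rw [show x - 2 * (s + 1 : ℕ) + 2 * (1 : ℕ) = x - 2 * s by push_cast; ring, add_zero] at h2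
      linarith
  have hsum := sum_size_of_even size 0 hn
  rcases le_total (altSum size 0 (m + 1)) (altSum size (0 + 1) (m + 1)) with h | h
  · exact aliceCanEat_of_le_altSum (m := m) (by omega) (0 + 1) fun s _ => by rw [hper]; linarith
  · exact aliceCanEat_of_le_altSum (m := m) (by omega) 0 fun s _ => by rw [hper]; linarith

/-! ### Minimal triples of cuts -/

/-- Three cuts, at `b`, `b + 2 * k₁ + 1` and `b + 2 * k₁ + 2 * k₂ + 2`, that divide the pizza into
segments of the odd lengths `2 * k₁ + 1`, `2 * k₂ + 1` and `2 * k₃ + 1`, and whose cut sums are less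
than `c`. -/
structure CutTriple (size : ZMod n → ℝ) (m : ℕ) (c : ℝ) (b : ZMod n) (k₁ k₂ k₃ : ℕ) : Prop where
  sum_eq : k₁ + k₂ + k₃ + 1 = m
  lt₁ : altSum size b (m + 1) < c
  lt₂ : altSum size (b + 2 * k₁ + 1) (m + 1) < c
  lt₃ : altSum size (b + 2 * k₁ + 1 + 2 * k₂ + 1) (m + 1) < c

/-- The sum of the three cut sums of a triple. -/
noncomputable def tripleSum (size : ZMod n → ℝ) (m : ℕ) (b : ZMod n) (k₁ k₂ : ℕ) : ℝ :=
  altSum size b (m + 1) + altSum size (b + 2 * k₁ + 1) (m + 1) +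
    altSum size (b + 2 * k₁ + 1 + 2 * k₂ + 1) (m + 1)

/-- A triple of cuts with cut sums less than `c` for which the sum of the cut sums is minimal. -/
structure MinCutTriple (size : ZMod n → ℝ) (m : ℕ) (c : ℝ) (b : ZMod n) (k₁ k₂ k₃ : ℕ) : Prop
    extends CutTriple size m c b k₁ k₂ k₃ where
  le : ∀ b' k₁' k₂' k₃', CutTriple size m c b' k₁' k₂' k₃' →
    tripleSum size m b k₁ k₂ ≤ tripleSum size m b' k₁' k₂'

theorem two_mul_add_one_eq_zero {m : ℕ} (hn : n = 2 * m + 1) : (2 : ZMod n) * m + 1 = 0 := by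
  have : ((2 * m + 1 : ℕ) : ZMod n) = 0 := by rw [← hn, ZMod.natCast_self]
  exact_mod_cast this

/-- If following Bob yields less than `c` from every first piece, then there are three cuts with cut
sums less than `c`: two of them do not suffice, because two neighbouring cut sums add up to at least
the whole pizza. -/
theorem exists_cutTriple [NeZero n] {size : ZMod n → ℝ} (hsize : ∀ p, 0 ≤ size p) {c : ℝ} {m : ℕ}
    (hn : n = 2 * m + 1) (hc : 2 * c ≤ ∑ p, size p)
    (H : ∀ x, ∃ s ≤ m, altSum size (x - 2 * s) (m + 1) < c) :
    ∃ b k₁ k₂ k₃, CutTriple size m c b k₁ k₂ k₃ := by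
  classical
  have h0 := two_mul_add_one_eq_zero hn
  obtain ⟨s₀, -, hb⟩ := H 0
  set b : ZMod n := 0 - 2 * s₀ with hbdef
  -- the last cut at an even distance from `b`, and the first one at an odd distance
  have hex : ∃ i, i ≤ m ∧ altSum size (b + 2 * ((m - i : ℕ) : ZMod n)) (m + 1) < c :=
    ⟨m, le_rfl, by simpa using hb⟩
  have hex' : ∃ z : ℕ, altSum size (b + 2 * (z : ZMod n) + 1) (m + 1) < c :=
    ⟨m, by rwa [add_assoc, h0, add_zero]⟩
  obtain ⟨hi, hy⟩ := Nat.find_spec hex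
  have hzm : Nat.find hex' ≤ m := Nat.find_min' hex' (by rwa [add_assoc, h0, add_zero])
  have hz := Nat.find_spec hex'
  have hzmin : ∀ z < Nat.find hex', ¬ altSum size (b + 2 * (z : ZMod n) + 1) (m + 1) < c :=
    fun z h => Nat.find_min hex' h
  have hymin : ∀ y, m - Nat.find hex < y → y ≤ m →
      ¬ altSum size (b + 2 * (y : ZMod n)) (m + 1) < c := fun y h1 h2 h3 =>
    Nat.find_min hex (m := m - y) (by omega)
      ⟨by omega, by rwa [show m - (m - y) = y by omega]⟩
  generalize Nat.find hex' = z at *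
  have hym : m - Nat.find hex ≤ m := Nat.sub_le _ _
  generalize m - Nat.find hex = y at *
  rcases lt_trichotomy z y with hzy | rfl | hyz
  · refine ⟨b, z, y - z - 1, m - y, by omega, hb, hz, ?_⟩
    convert hy using 2
    obtain ⟨d, rfl⟩ : ∃ d, y = z + 1 + d := ⟨y - (z + 1), by omega⟩
    rw [show z + 1 + d - z - 1 = d by omega]
    push_cast
    ring
  · exfalso
    have h1 := sum_size_of_odd size (b + 2 * (z : ZMod n)) hn
    have h2 := altSum_add size (b + 2 * (z : ZMod n) + 1) m 1
    have h3 := altSum_nonneg hsize (b + 2 * (z : ZMod n) + 1 + 2 * m) 1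
    linarith
  · exfalso
    obtain ⟨s, hs, h⟩ := H (b + 2 * (y : ZMod n) + 1)
    rcases le_or_gt s y with hsy | hsy
    · refine hzmin (y - s) (by omega) ?_
      convert h using 2
      push_cast [Nat.cast_sub hsy]
      ring
    · refine hymin (y + m + 1 - s) (by omega) (by omega) ?_
      convert h using 2
      push_cast [Nat.cast_sub (show s ≤ y + m + 1 by omega)]
      linear_combination h0

theorem exists_minCutTriple [NeZero n] {size : ZMod n → ℝ} {c : ℝ} {m : ℕ}
    (H : ∃ b k₁ k₂ k₃, CutTriple size m c b k₁ k₂ k₃) :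
    ∃ b k₁ k₂ k₃, MinCutTriple size m c b k₁ k₂ k₃ := by
  let S : Set (ZMod n × ℕ × ℕ × ℕ) := {x | CutTriple size m c x.1 x.2.1 x.2.2.1 x.2.2.2}
  have hfin : S.Finite := by
    refine (Set.finite_univ.prod ((Set.finite_Iic m).prod
      ((Set.finite_Iic m).prod (Set.finite_Iic m)))).subset ?_
    rintro ⟨b, k₁, k₂, k₃⟩ h
    have := h.sum_eq
    simp only [Set.mem_prod, Set.mem_univ, Set.mem_Iic, true_and] at this ⊢
    omega
  obtain ⟨b, k₁, k₂, k₃, h⟩ := H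
  obtain ⟨⟨b, k₁, k₂, k₃⟩, h1, h2⟩ := Set.exists_min_image S
    (fun x => tripleSum size m x.1 x.2.1 x.2.2.1) hfin ⟨(b, k₁, k₂, k₃), h⟩
  exact ⟨b, k₁, k₂, k₃, h1, fun b' k₁' k₂' k₃' h' => h2 (b', k₁', k₂', k₃') h'⟩

section CutTriple

variable {size : ZMod n → ℝ} {c : ℝ} {m k₁ k₂ k₃ : ℕ} {b : ZMod n}

theorem CutTriple.add_eq (hn : n = 2 * m + 1) (h : CutTriple size m c b k₁ k₂ k₃) :
    b + 2 * k₁ + 1 + 2 * k₂ + 1 + 2 * k₃ + 1 = b := by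
  have h0 := two_mul_add_one_eq_zero hn
  rw [← h.sum_eq] at h0
  push_cast at h0
  linear_combination h0

theorem MinCutTriple.rotate (hn : n = 2 * m + 1) (h : MinCutTriple size m c b k₁ k₂ k₃) :
    MinCutTriple size m c (b + 2 * k₁ + 1) k₂ k₃ k₁ := by
  have e := h.add_eq hn
  refine ⟨⟨by have := h.sum_eq; omega, h.lt₂, h.lt₃, by rw [e]; exact h.lt₁⟩, ?_⟩
  intro b' k₁' k₂' k₃' h'
  refine le_trans (le_of_eq ?_) (h.le b' k₁' k₂' k₃' h')
  rw [tripleSum, tripleSum, e]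
  ring

theorem MinCutTriple.le_add (h : MinCutTriple size m c b k₁ k₂ k₃) {t : ℕ} (ht : t ≤ k₁) :
    altSum size b (m + 1) ≤ altSum size (b + 2 * t) (m + 1) := by
  by_contra! hlt
  have e : b + 2 * (t : ZMod n) + 2 * ((k₁ - t : ℕ) : ZMod n) = b + 2 * k₁ := by
    push_cast [Nat.cast_sub ht]; ring
  have h' : CutTriple size m c (b + 2 * t) (k₁ - t) k₂ (k₃ + t) :=
    ⟨by have := h.sum_eq; omega, hlt.trans h.lt₁, by rw [e]; exact h.lt₂, by rw [e]; exact h.lt₃⟩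
  have := h.le _ _ _ _ h'
  rw [tripleSum, tripleSum, e] at this
  linarith

theorem MinCutTriple.le_sub (h : MinCutTriple size m c b k₁ k₂ k₃) {t : ℕ} (ht : t ≤ k₃) :
    altSum size b (m + 1) ≤ altSum size (b - 2 * t) (m + 1) := by
  by_contra! hlt
  have e : b - 2 * (t : ZMod n) + 2 * ((k₁ + t : ℕ) : ZMod n) = b + 2 * k₁ := by
    push_cast; ring
  have h' : CutTriple size m c (b - 2 * t) (k₁ + t) k₂ (k₃ - t) :=
    ⟨by have := h.sum_eq; omega, hlt.trans h.lt₁, by rw [e]; exact h.lt₂, by rw [e]; exact h.lt₃⟩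
  have := h.le _ _ _ _ h'
  rw [tripleSum, tripleSum, e] at this
  linarith

/-- Going around the pizza from `b` backwards in steps of two up to the start of the first segment,
one passes cuts whose sums are at least that of one of the two cuts bounding the first segment. -/
theorem MinCutTriple.min_le_sub (hn : n = 2 * m + 1) (h : MinCutTriple size m c b k₁ k₂ k₃) {y : ℕ}
    (hy : y ≤ m) : min (altSum size b (m + 1)) (altSum size (b + 2 * k₁ + 1) (m + 1)) ≤
      altSum size (b - 2 * y) (m + 1) := by
  have h0 := two_mul_add_one_eq_zero hn
  have hs := h.sum_eq
  rcases le_or_gt y k₃ with h3 | h3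
  · exact (min_le_left _ _).trans (h.le_sub h3)
  refine (min_le_right _ _).trans ?_
  rcases le_or_gt y (m - k₁) with h1 | h1
  · have e : b - 2 * (y : ZMod n) = b + 2 * k₁ + 1 + 2 * ((m - k₁ - y : ℕ) : ZMod n) := by
      push_cast [Nat.cast_sub h1, Nat.cast_sub (show k₁ ≤ m by omega)]
      linear_combination -h0
    rw [e]
    exact (h.rotate hn).le_add (by omega)
  · have e : b - 2 * (y : ZMod n) = b + 2 * k₁ + 1 - 2 * ((y - (m - k₁) : ℕ) : ZMod n) := by
      push_cast [Nat.cast_sub h1.le, Nat.cast_sub (show k₁ ≤ m by omega)]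
      linear_combination -h0
    rw [e]
    exact (h.rotate hn).le_sub (by omega)

/-- Alice starts in the first segment and plays there as in `exists_lineWin_segment`; once the
game leaves the segment she follows Bob. -/
theorem MinCutTriple.aliceCanEat [NeZero n] (hsize : ∀ p, 0 ≤ size p) (hn : n = 2 * m + 1)
    (h : MinCutTriple size m c b k₁ k₂ k₃) {a : ℝ}
    (ha : a ≤ min (altSum size b (m + 1)) (altSum size (b + 2 * k₁ + 1) (m + 1)) -
      3 / 4 * altSum size b (k₁ + 1) + altSum size (b + 1) k₁ / 2) : AliceCanEat size a := by
  have hs := h.sum_eq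
  suffices ∃ x, LineWin (fun i => size (b + (i : ZMod n))) m x (x + 1)
      (a - size (b + (x : ZMod n))) by
    obtain ⟨x, hx⟩ := this
    refine aliceCanEat_of_lineWin b x ?_
    rwa [show (n - 1) / 2 = m by omega]
  refine exists_lineWin_segment (f := fun i => size (b + (i : ZMod n))) (m := m) (k := k₁)
    (M := min (altSum size b (m + 1)) (altSum size (b + 2 * k₁ + 1) (m + 1))) (c := a)
    (fun i => hsize _) (by omega) ?_ ?_ (by rwa [evenSum_size, oddSum_size])
  · intro s hs c' hc'
    rw [evenSum_size] at hc'
    have := lineWin_of_le_altSum (size := size) (b := b) (m := m) (j := s) (by omega) 0 c'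
      fun u hu => ?_
    · simpa using this
    · have := h.min_le_sub hn (y := u) (by omega)
      simp only [Int.cast_zero, add_zero]
      linarith
  · intro s hs c' hc'
    have hc'' : c' + altSum size (b + 2 * s) (k₁ - s + 1) ≤
        min (altSum size b (m + 1)) (altSum size (b + 2 * k₁ + 1) (m + 1)) := by
      rw [evenSum_size, evenSum_size, show k₁ + 1 = s + (k₁ - s + 1) by omega, altSum_add] at hc'
      linarith
    have := lineWin_of_le_altSum (size := size) (b := b) (m := m) (j := k₁ - s) (by omega)
      (2 * s) c' fun u hu => ?_
    · convert this using 1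
      omega
    · push_cast
      refine hc''.trans ?_
      rcases le_total u s with hus | hus
      · refine (min_le_left _ _).trans ?_
        have e : b + 2 * (s : ZMod n) - 2 * u = b + 2 * ((s - u : ℕ) : ZMod n) := by
          push_cast [Nat.cast_sub hus]; ring
        rw [e]
        exact h.le_add (by omega)
      · have e : b + 2 * (s : ZMod n) - 2 * u = b - 2 * ((u - s : ℕ) : ZMod n) := by
          push_cast [Nat.cast_sub hus]; ring
        rw [e]
        exact h.min_le_sub hn (by omega)

theorem CutTriple.altSum_eq (h : CutTriple size m c b k₁ k₂ k₃) :
    altSum size b (m + 1) = altSum size b (k₁ + 1) + altSum size (b + 2 * k₁ + 1 + 1) k₂ +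
      altSum size (b + 2 * k₁ + 1 + 2 * k₂ + 1) (k₃ + 1) := by
  rw [show m + 1 = k₁ + 1 + (k₂ + (k₃ + 1)) by have := h.sum_eq; omega,
    altSum_add _ _ (k₁ + 1), altSum_add _ _ k₂, ← add_assoc]
  push_cast
  ring_nf

theorem CutTriple.altSum_add_one_eq (h : CutTriple size m c b k₁ k₂ k₃) :
    altSum size (b + 1) m = altSum size (b + 1) k₁ + altSum size (b + 2 * k₁ + 1) (k₂ + 1) +
      altSum size (b + 2 * k₁ + 1 + 2 * k₂ + 1 + 1) k₃ := by
  rw [show m = k₁ + ((k₂ + 1) + k₃) by have := h.sum_eq; omega,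
    altSum_add _ _ k₁, altSum_add _ _ (k₂ + 1), ← add_assoc]
  push_cast
  ring_nf

end CutTriple

end AltSum

end Pizza

/-! ### The guarantee of four ninths -/

theorem mainTheorem1 (n : ℕ) [NeZero n] (size : ZMod n → ℝ) (hsize : ∀ p, 0 ≤ size p) :
    Pizza.AliceCanEat size (4 / 9 * ∑ p, size p) := by
  have hT : 0 ≤ ∑ p, size p := Finset.sum_nonneg fun p _ => hsize p
  rcases Nat.even_or_odd' n with ⟨m, hn | hn⟩
  · obtain ⟨m, rfl⟩ : ∃ m', m = m' + 1 := ⟨m - 1, by have := NeZero.pos n; omega⟩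
    exact Pizza.aliceCanEat_of_even hn (by linarith)
  by_contra hcon
  have H : ∀ x, ∃ s ≤ m, Pizza.altSum size (x - 2 * s) (m + 1) < 4 / 9 * ∑ p, size p := by
    intro x
    by_contra! hx
    exact hcon (Pizza.aliceCanEat_of_le_altSum (by omega) x hx)
  obtain ⟨b, k₁, k₂, k₃, h⟩ := Pizza.exists_minCutTriple
    (Pizza.exists_cutTriple hsize hn (by linarith) H)
  have h' := h.rotate hn
  have h'' := h'.rotate hn
  have g := not_le.1 fun hc => hcon (h.aliceCanEat hsize hn hc)
  have g' := not_le.1 fun hc => hcon (h'.aliceCanEat hsize hn hc)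
  have g'' := not_le.1 fun hc => hcon (h''.aliceCanEat hsize hn hc)
  have e := h.add_eq hn
  have t := Pizza.sum_size_of_odd size b hn
  have c := h.altSum_eq
  have c' := h'.altSum_eq
  have c'' := h''.altSum_eq
  have l := h.lt₁
  have l' := h'.lt₁
  have l'' := h''.lt₁
  rw [h.altSum_add_one_eq] at t
  rw [e] at c' c'' g''
  have n1 := Pizza.altSum_nonneg hsize b (k₁ + 1)
  have n2 := Pizza.altSum_nonneg hsize (b + 2 * k₁ + 1) (k₂ + 1)
  have n3 := Pizza.altSum_nonneg hsize (b + 2 * k₁ + 1 + 2 * k₂ + 1) (k₃ + 1)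
  rw [c, c'] at g
  rw [c', c''] at g'
  rw [c, c''] at g''
  rw [c] at l t
  rw [c'] at l'
  rw [c''] at l''
  generalize Pizza.altSum size b (k₁ + 1) = o₁ at *
  generalize Pizza.altSum size (b + 2 * k₁ + 1) (k₂ + 1) = o₂ at *
  generalize Pizza.altSum size (b + 2 * k₁ + 1 + 2 * k₂ + 1) (k₃ + 1) = o₃ at *
  generalize Pizza.altSum size (b + 1) k₁ = e₁ at *
  generalize Pizza.altSum size (b + 2 * k₁ + 1 + 1) k₂ = e₂ at *
  generalize Pizza.altSum size (b + 2 * k₁ + 1 + 2 * k₂ + 1 + 1) k₃ = e₃ at *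
  -- Whatever minima occur, the strategies for two of the segments and one cut sum, with the weights
  -- `1`, `1 / 2` and `3 / 4`, yield `9 / 4 * (4 / 9)` of the pizza.
  rw [sub_add, sub_lt_iff_lt_add, min_lt_iff] at g g' g''
  rcases g with g | g <;> rcases g' with g' | g' <;> rcases g'' with g'' | g'' <;> linarith
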